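/- Fix a set $\mathcal F$ of function symbols, each $f\in\mathcal F$ having an arity $\alpha_f\in\mathbb N$, and an infinite set $\mathcal X$ of variables. Terms are the $\lambda$-terms $t,u ::= f\in\mathcal F \mid x\in\mathcal X \mid t\,u \mid \lambda x.t$, modulo $\alpha$-conversion. A term is algebraic if it contains no abstraction and no subterm of the form $x\,t$ with $x\in\mathcal X$. It is arity-compliant if it contains no subterm of the form $f\,t_1\cdots t_n$ with $f\in\mathcal F$ and $n>\alpha_f$. A rewrite relation is a binary relation on terms closed under abstraction, under application on both sides, and under capture-avoiding substitution. For a relation $\to$, let $\to^*$ be its reflexive-transitive closure, and write $s\downarrow t$ if there is $w$ with $s\to^* w$ and $t\to^* w$. Let $\to_\beta$ be $\beta$-reduction. A conditional rewrite system $\mathcal R$ is a set of rules $d_1=c_1\wedge\dots\wedge d_n=c_n\supset l\to r$ with $n\ge 0$, where $l$ is a non-variable algebraic term, the $d_i$, $c_i$ and $r$ are terms, and all free variables of the $d_i$, $c_i$ and $r$ are free in $l$. The system is algebraic if all terms $l,r,d_i,c_i$ of its rules are algebraic. It is arity-compliant if all these terms are arity-compliant and every left-hand side is of the form $f\,l_1\cdots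 l_k$ with $f\in\mathcal F$ and $k=\alpha_f$. Let $\to_{A_0}=\emptyset$, let $\to_{A_{i+1}}$ be the smallest rewrite relation such that $l\sigma\to_{A_{i+1}} r\sigma$ for every rule as above in $\mathcal R$ and every substitution $\sigma$ with $d_j\sigma\downarrow_{A_i}c_j\sigma$ for all $j$, and let $\to_A=\bigcup_{i\ge 0}\to_{A_i}$. Theorem. Let $\mathcal R$ be an arity-compliant algebraic conditional rewrite system such that $\to_A$ is confluent. Then $\to_{\beta\cup A}={\to_\beta}\cup{\to_A}$ is confluent on the set $\mathcal U$ of terms that have an arity-compliant $\beta$-normal form: for all $s\in\mathcal U$ and all terms $t,u$ with $s\to^*_{\beta\cup A}t$ and $s\to^*_{\beta\cup A}u$, one has $t\downarrow_{\beta\cup A}u$. -/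

import Mathlib

namespace LamRew

universe u v

/-- Lambda-terms with curried constants from `F`, modulo alpha-conversion, whose free variables
are taken from `V`. The body of an abstraction has one more variable available, `none`, which is
the variable bound by this abstraction. -/
inductive Term (F : Type u) : Type v → Type (max u (v + 1)) where
  | sym {V : Type v} (f : F) : Term F V
  | var {V : Type v} (x : V) : Term F V
  | app {V : Type v} (t s : Term F V) : Term F V
  | lam {V : Type v} (t : Term F (Option V)) : Term F V

namespace Term

variable {F : Type u}

/-- Renaming of the free variables. -/
def rename : {V W : Type v} → (V → W) → Term F V → Term F W
  | _, _, _, sym f => sym f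
  | _, _, ρ, var x => var (ρ x)
  | _, _, ρ, app t s => app (t.rename ρ) (s.rename ρ)
  | _, _, ρ, lam t => lam (t.rename (Option.map ρ))

/-- A substitution passing under a binder: the bound variable is left alone, and the variables of
the substituted terms are kept apart from it. -/
def liftSubst {V W : Type v} (σ : V → Term F W) : Option V → Term F (Option W)
  | none => var none
  | some x => (σ x).rename some

/-- Capture-avoiding application of the substitution `σ`. -/
def subst : {V W : Type v} → (V → Term F W) → Term F V → Term F W
  | _, _, _, sym f => sym f
  | _, _, σ, var x => σ x
  | _, _, σ, app t s => app (t.subst σ) (s.subst σ)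
  | _, _, σ, lam t => lam (t.subst (liftSubst σ))

/-- `s.inst t` replaces the variable `none` by `t` in `s`. -/
def inst {V : Type v} (s : Term F (Option V)) (t : Term F V) : Term F V :=
  s.subst (fun o => o.elim t var)

/-- The set of free variables. -/
def FV : {V : Type v} → Term F V → Set V
  | _, sym _ => ∅
  | _, var x => {x}
  | _, app t s => t.FV ∪ s.FV
  | _, lam t => {x | some x ∈ t.FV}

/-- `apps h [t₁, …, tₙ]` is `h t₁ … tₙ`. -/
def apps {V : Type v} (h : Term F V) (ts : List (Term F V)) : Term F V :=
  ts.foldl app h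

/-- `Subterm s t`: `s` is a subterm of `t`. The variables bound in `t` above `s` are free
variables of `s`. -/
inductive Subterm : {V W : Type v} → Term F V → Term F W → Prop where
  | refl {V : Type v} (t : Term F V) : Subterm t t
  | app_left {V W : Type v} {s : Term F V} {t : Term F W} (u : Term F W) :
      Subterm s t → Subterm s (app t u)
  | app_right {V W : Type v} {s : Term F V} (t : Term F W) {u : Term F W} :
      Subterm s u → Subterm s (app t u)
  | lam {V W : Type v} {s : Term F V} {t : Term F (Option W)} :
      Subterm s t → Subterm s (lam t)

/-- A term is applicative if it contains no abstraction. -/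
def Applicative {V : Type v} (t : Term F V) : Prop :=
  ∀ (W : Type v) (s : Term F (Option W)), ¬ Subterm (lam s) t

/-- A term is algebraic if it is applicative and contains no subterm `x s` with `x` a variable. -/
def Algebraic {V : Type v} (t : Term F V) : Prop :=
  t.Applicative ∧ ∀ (W : Type v) (x : W) (s : Term F W), ¬ Subterm (app (var x) s) t

/-- A term is arity-compliant, for the arities `ar`, if it contains no subterm `f t₁ … tₙ` with
`n > ar f`. -/
def ArityCompliant (ar : F → ℕ) {V : Type v} (t : Term F V) : Prop :=
  ∀ (W : Type v) (f : F) (ts : List (Term F W)),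
    Subterm (apps (sym f) ts) t → ts.length ≤ ar f

end Term

/-- Binary relations on terms. -/
abbrev Rel (F : Type u) := ∀ V : Type v, Term F V → Term F V → Prop

/-- The smallest rewrite relation containing `B`: closed under abstraction, application on both
sides, and substitution. -/
inductive RewriteClosure {F : Type u} (B : Rel.{u, v} F) :
    ∀ V : Type v, Term F V → Term F V → Prop where
  | base {V : Type v} {s t : Term F V} : B V s t → RewriteClosure B V s t
  | lam {V : Type v} {s t : Term F (Option V)} :
      RewriteClosure B (Option V) s t → RewriteClosure B V (Term.lam s) (Term.lam t)
  | app_left {V : Type v} {s t : Term F V} (u : Term F V) :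
      RewriteClosure B V s t → RewriteClosure B V (Term.app s u) (Term.app t u)
  | app_right {V : Type v} (u : Term F V) {s t : Term F V} :
      RewriteClosure B V s t → RewriteClosure B V (Term.app u s) (Term.app u t)
  | subst {V W : Type v} {s t : Term F V} (σ : V → Term F W) :
      RewriteClosure B V s t → RewriteClosure B W (s.subst σ) (t.subst σ)

/-- The contraction of a beta-redex at the root. -/
inductive BetaRoot {F : Type u} : ∀ V : Type v, Term F V → Term F V → Prop where
  | mk {V : Type v} (s : Term F (Option V)) (t : Term F V) :
      BetaRoot V (Term.app (Term.lam s) t) (s.inst t)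

/-- Beta-reduction. -/
def Beta (F : Type u) : Rel.{u, v} F := RewriteClosure BetaRoot

/-- Joinability: a common reduct for the reflexive and transitive closure of `r`. -/
def Joinable {α : Type*} (r : α → α → Prop) (s t : α) : Prop :=
  ∃ w, Relation.ReflTransGen r s w ∧ Relation.ReflTransGen r t w

/-- `r` is confluent on `S`: any two reducts of an element of `S` are joinable. -/
def ConfluentOn {α : Type*} (r : α → α → Prop) (S : Set α) : Prop :=
  ∀ s ∈ S, ∀ t u : α,
    Relation.ReflTransGen r s t → Relation.ReflTransGen r s u → Joinable r t u

/-- `r` is confluent. -/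
def Confluent {α : Type*} (r : α → α → Prop) : Prop := ConfluentOn r Set.univ

/-- A conditional rewrite rule `d₁ = c₁ ∧ … ∧ dₙ = cₙ ⊃ l → r` over the variables `X`; the
conditions are listed as the pairs `(dᵢ, cᵢ)`. -/
structure Rule (F : Type u) (X : Type v) where
  conds : List (Term F X × Term F X)
  lhs : Term F X
  rhs : Term F X
  lhs_algebraic : lhs.Algebraic
  lhs_ne_var : ∀ x : X, lhs ≠ Term.var x
  fv_rhs : rhs.FV ⊆ lhs.FV
  fv_conds : ∀ p ∈ conds, p.1.FV ⊆ lhs.FV ∧ p.2.FV ⊆ lhs.FV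

/-- An algebraic rule is made of algebraic terms. -/
def Rule.Algebraic {F : Type u} {X : Type v} (ρ : Rule F X) : Prop :=
  ρ.lhs.Algebraic ∧ ρ.rhs.Algebraic ∧ ∀ p ∈ ρ.conds, p.1.Algebraic ∧ p.2.Algebraic

/-- A rule is arity-compliant if all its terms are and its left-hand side is of the form
`f l₁ … lₙ` with `n = ar f`. -/
def Rule.ArityCompliant {F : Type u} {X : Type v} (ar : F → ℕ) (ρ : Rule F X) : Prop :=
  ρ.lhs.ArityCompliant ar ∧ ρ.rhs.ArityCompliant ar ∧
    (∃ (f : F) (ls : List (Term F X)), ρ.lhs = Term.apps (Term.sym f) ls ∧ ls.length = ar f) ∧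
    ∀ p ∈ ρ.conds, p.1.ArityCompliant ar ∧ p.2.ArityCompliant ar

/-- The instances `lσ → rσ` of the rules of `R` whose instantiated conditions `dᵢσ`, `cᵢσ` are
joinable for the relation `A`. -/
inductive RuleInstance {F : Type u} {X : Type v} (R : Set (Rule F X)) (A : Rel.{u, v} F) :
    ∀ V : Type v, Term F V → Term F V → Prop where
  | mk {V : Type v} (ρ : Rule F X) (σ : X → Term F V) (hρ : ρ ∈ R)
      (hσ : ∀ p ∈ ρ.conds, Joinable (A V) (p.1.subst σ) (p.2.subst σ)) :
      RuleInstance R A V (ρ.lhs.subst σ) (ρ.rhs.subst σ)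

/-- The `i`-th approximation of the conditional rewrite relation. -/
def CondStepAt {F : Type u} {X : Type v} (R : Set (Rule F X)) : ℕ → Rel.{u, v} F
  | 0 => fun _ _ _ => False
  | i + 1 => RewriteClosure (RuleInstance R (CondStepAt R i))

/-- The join conditional rewrite relation induced by `R`; beta-reduction is not used in the
evaluation of the conditions. -/
def CondStep {F : Type u} {X : Type v} (R : Set (Rule F X)) : Rel.{u, v} F :=
  fun V s t => ∃ i : ℕ, CondStepAt R i V s t

/-- The union of beta-reduction and of the conditional rewrite relation induced by `R`. -/
def BetaCondStep {F : Type u} {X : Type v} (R : Set (Rule F X)) : Rel.{u, v} F :=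
  fun V s t => Beta F V s t ∨ CondStep R V s t

/-- `n` is a beta-normal form of `t`. -/
def IsBetaNormalForm {F : Type u} {V : Type v} (t n : Term F V) : Prop :=
  Relation.ReflTransGen (Beta F V) t n ∧ ∀ m : Term F V, ¬ Beta F V n m

/-- The set of terms that have an arity-compliant beta-normal form. -/
def ArityCompliantNF {F : Type u} (ar : F → ℕ) (V : Type v) : Set (Term F V) :=
  {t | ∃ n : Term F V, IsBetaNormalForm t n ∧ n.ArityCompliant ar}

end LamRew

namespace LamRew

universe u v

/-! Reductions project onto β-normal forms. If `s` has an arity-compliant β-normal form `n` and s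
→_{β∪A} t, then `t` has an arity-compliant β-normal form `n'` with n →*_A n'
(`projects_betaCondStep`). Two reducts of `s` therefore β-reduce to two A-reducts of the single term
`n`, and confluence of →_A closes the diagram.

The projection exists because the hypotheses keep rules from interacting with β. A left-hand side is
`f` applied to exactly `ar f` arguments. Once the head of a spine is atomic, compliance of the
normal form bounds the length of the spine, so no rule fires on a proper prefix of it
(`Par.apps_inv`): a contractum never receives further arguments. Variables of algebraic terms are
never applied either, so normalisation commutes with instantiation: if θ x is the normal form of σ
x, then dθ is that of dσ (`Algebraic.norm_subst`). The rule thus applies again to the normal form.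
Left-linearity plays no role, since θ x depends only on σ x.

Terms need not be strongly normalising. The inner induction is on the height of a leftmost
normalisation derivation (`NormAt`), which standardisation provides (`norm_of_isBetaNormalForm`).
Since a head step may copy or erase redexes, the reduction carried along it is a parallel one
(`Par`), which commutes with head steps (`Par.headStep`). The outer induction, on the level i of
→_{A_i}, transfers the conditions of a rule from σ to θ (`Projects.joinable`). -/

theorem reflTransGen_map {α β : Type*} {r : α → α → Prop} {p : β → β → Prop} (f : α → β)
    (H : ∀ a b, r a b → p (f a) (f b)) {a b : α} (h : Relation.ReflTransGen r a b) :
    Relation.ReflTransGen p (f a) (f b) := by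
  induction h with
  | refl => exact .refl
  | tail _ hb ih => exact ih.tail (H _ _ hb)

theorem reflTransGen_mono {α : Type*} {r p : α → α → Prop} (H : ∀ a b, r a b → p a b) {a b : α}
    (h : Relation.ReflTransGen r a b) : Relation.ReflTransGen p a b :=
  reflTransGen_map id H h

namespace Term

variable {F : Type u}

/-! ### Calculus of renamings and substitutions -/

theorem rename_rename {V W U : Type v} (t : Term F V) (ρ : V → W) (τ : W → U) :
    (t.rename ρ).rename τ = t.rename (τ ∘ ρ) := by
  induction t generalizing W U with
  | sym f => rfl
  | var x => rfl
  | app t s iht ihs => simp [rename, iht, ihs]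
  | lam t ih => simp [rename, ih, Option.map_comp_map]

theorem liftSubst_comp_map {V W U : Type v} (ρ : V → W) (σ : W → Term F U) :
    liftSubst σ ∘ Option.map ρ = liftSubst (σ ∘ ρ) := by
  funext o
  cases o <;> rfl

theorem subst_rename {V W U : Type v} (t : Term F V) (ρ : V → W) (σ : W → Term F U) :
    (t.rename ρ).subst σ = t.subst (σ ∘ ρ) := by
  induction t generalizing W U with
  | sym f => rfl
  | var x => rfl
  | app t s iht ihs => simp [rename, subst, iht, ihs]
  | lam t ih => simp [rename, subst, ih, liftSubst_comp_map]

theorem liftSubst_rename {V W U : Type v} (σ : V → Term F W) (ρ : W → U) :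
    (fun o => (liftSubst σ o).rename (Option.map ρ)) = liftSubst fun x => (σ x).rename ρ := by
  funext o
  cases o with
  | none => rfl
  | some x =>
    simp only [liftSubst, rename_rename]
    rfl

theorem rename_subst {V W U : Type v} (t : Term F V) (σ : V → Term F W) (ρ : W → U) :
    (t.subst σ).rename ρ = t.subst fun x => (σ x).rename ρ := by
  induction t generalizing W U with
  | sym f => rfl
  | var x => rfl
  | app t s iht ihs => simp [rename, subst, iht, ihs]
  | lam t ih => simp [rename, subst, ih, liftSubst_rename]

theorem liftSubst_subst {V W U : Type v} (σ : V → Term F W) (τ : W → Term F U) :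
    (fun o => (liftSubst σ o).subst (liftSubst τ)) = liftSubst fun x => (σ x).subst τ := by
  funext o
  cases o with
  | none => rfl
  | some x =>
    simp only [liftSubst, subst_rename, rename_subst]
    rfl

theorem subst_subst {V W U : Type v} (t : Term F V) (σ : V → Term F W) (τ : W → Term F U) :
    (t.subst σ).subst τ = t.subst fun x => (σ x).subst τ := by
  induction t generalizing W U with
  | sym f => rfl
  | var x => rfl
  | app t s iht ihs => simp [subst, iht, ihs]
  | lam t ih => simp [subst, ih, liftSubst_subst]

theorem liftSubst_var_comp {V W : Type v} (ρ : V → W) :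
    liftSubst (fun x => (var (ρ x) : Term F W)) = fun o => var (Option.map ρ o) := by
  funext o
  cases o <;> rfl

theorem rename_eq_subst {V W : Type v} (t : Term F V) (ρ : V → W) :
    t.rename ρ = t.subst fun x => var (ρ x) := by
  induction t generalizing W with
  | sym f => rfl
  | var x => rfl
  | app t s iht ihs => simp [rename, subst, iht, ihs]
  | lam t ih => simp [rename, subst, ih, liftSubst_var_comp]

theorem subst_var {V : Type v} (t : Term F V) : t.subst var = t := by
  induction t with
  | sym f => rfl
  | var x => rfl
  | app t s iht ihs => simp [subst, iht, ihs]
  | @lam V t ih =>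
    have h : liftSubst (var : V → Term F V) = var := by
      funext o
      cases o <;> rfl
    simp [subst, h, ih]

theorem inst_subst {V W : Type v} (s : Term F (Option V)) (t : Term F V) (σ : V → Term F W) :
    (s.inst t).subst σ = (s.subst (liftSubst σ)).inst (t.subst σ) := by
  simp only [inst, subst_subst]
  congr 1
  funext o
  cases o with
  | none => rfl
  | some x =>
    simp only [Option.elim, liftSubst, subst, subst_rename]
    exact (subst_var _).symm

theorem inst_rename {V W : Type v} (s : Term F (Option V)) (t : Term F V) (ρ : V → W) :
    (s.inst t).rename ρ = (s.rename (Option.map ρ)).inst (t.rename ρ) := by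
  simp only [rename_eq_subst, inst_subst, liftSubst_var_comp]

/-! ### Spines with an atomic head -/

theorem apps_concat {V : Type v} (h : Term F V) (ts : List (Term F V)) (t : Term F V) :
    apps h (ts ++ [t]) = app (apps h ts) t := by
  simp [apps]

theorem apps_subst {V W : Type v} (h : Term F V) (ts : List (Term F V)) (σ : V → Term F W) :
    (apps h ts).subst σ = apps (h.subst σ) (ts.map (subst σ)) := by
  induction ts using List.reverseRecOn with
  | nil => rfl
  | append_singleton ts t ih => simp only [List.map_append, List.map_cons, List.map_nil,
      apps_concat, subst, ih]

/-- Function symbols and variables. -/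
inductive Atomic {V : Type v} : Term F V → Prop where
  | sym (f : F) : Atomic (sym f)
  | var (x : V) : Atomic (var x)

theorem Atomic.apps_ne_lam {V : Type v} {h : Term F V} (hh : h.Atomic) (ts : List (Term F V))
    (a : Term F (Option V)) : apps h ts ≠ lam a := by
  induction ts using List.reverseRecOn with
  | nil => cases hh <;> simp [apps]
  | append_singleton ts t ih => simp [apps_concat]

theorem Atomic.ne_app {V : Type v} {h : Term F V} (hh : h.Atomic) (a b : Term F V) :
    h ≠ app a b := by
  cases hh <;> simp

theorem Atomic.apps_inj {V : Type v} {h h' : Term F V} (hh : h.Atomic) (hh' : h'.Atomic)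
    {ts ts' : List (Term F V)} (e : apps h ts = apps h' ts') : h = h' ∧ ts = ts' := by
  induction ts using List.reverseRecOn generalizing ts' with
  | nil =>
    induction ts' using List.reverseRecOn with
    | nil => exact ⟨e, rfl⟩
    | append_singleton ts' t' _ =>
      rw [apps_concat] at e
      exact absurd e (hh.ne_app _ _)
  | append_singleton ts t ih =>
    induction ts' using List.reverseRecOn with
    | nil =>
      rw [apps_concat] at e
      exact absurd e.symm (hh'.ne_app _ _)
    | append_singleton ts' t' _ =>
      rw [apps_concat, apps_concat] at e
      injection e with _ e1 e2
      obtain ⟨h1, h2⟩ := ih e1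
      exact ⟨h1, by rw [h2, e2]⟩

/-! ### Arity compliance by structural recursion -/

/-- `t.CompliantAt ar k`: in `t s₁ … sₖ`, no function symbol occurring in `t` is applied to more
arguments than its arity. -/
def CompliantAt (ar : F → ℕ) : {V : Type v} → ℕ → Term F V → Prop
  | _, k, sym f => k ≤ ar f
  | _, _, var _ => True
  | _, k, app t s => t.CompliantAt ar (k + 1) ∧ s.CompliantAt ar 0
  | _, _, lam t => t.CompliantAt ar 0

theorem CompliantAt.mono {ar : F → ℕ} {V : Type v} {t : Term F V} {j k : ℕ} (hjk : j ≤ k)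
    (h : t.CompliantAt ar k) : t.CompliantAt ar j := by
  induction t generalizing j k with
  | sym f => exact hjk.trans h
  | var x => trivial
  | app t s iht ihs => exact ⟨iht (Nat.succ_le_succ hjk) h.1, h.2⟩
  | lam t ih => exact h

theorem compliantAt_apps {ar : F → ℕ} {V : Type v} {h : Term F V} {ts : List (Term F V)}
    {k : ℕ} : (apps h ts).CompliantAt ar k ↔
      h.CompliantAt ar (k + ts.length) ∧ ∀ t ∈ ts, t.CompliantAt ar 0 := by
  induction ts using List.reverseRecOn generalizing k with
  | nil => simp [apps]
  | append_singleton ts t ih =>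
    rw [apps_concat]
    simp only [CompliantAt, ih, List.mem_append, List.length_append, List.length_cons,
      List.length_nil, List.mem_singleton, or_imp, forall_and, forall_eq, and_assoc]
    rw [show k + 1 + ts.length = k + (ts.length + (0 + 1)) by omega]

theorem CompliantAt.subterm {ar : F → ℕ} {V W : Type v} {s : Term F V} {t : Term F W} {k : ℕ}
    (hs : Subterm s t) (h : t.CompliantAt ar k) : s.CompliantAt ar 0 := by
  induction hs generalizing k with
  | refl t => exact h.mono k.zero_le
  | app_left u _ ih => exact ih h.1
  | app_right t _ ih => exact ih h.2
  | lam _ ih => exact ih h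

/-- Only a symbol heading the spine of `t` itself sees the `k` extra arguments, which is what `hk`
controls; every other symbol is covered by `h`. -/
theorem ArityCompliant.compliantAt {ar : F → ℕ} {V : Type v} {t : Term F V} {k : ℕ}
    (h : t.ArityCompliant ar) (hk : ∀ f ts, t = apps (sym f) ts → k + ts.length ≤ ar f) :
    t.CompliantAt ar k := by
  induction t generalizing k with
  | sym f => exact hk f [] rfl
  | var x => trivial
  | app t s iht ihs =>
    refine ⟨iht (fun W f ts hs => h W f ts (hs.app_left s)) fun f ts e => ?_,
      ihs (fun W f ts hs => h W f ts (hs.app_right t)) fun f ts e => ?_⟩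
    · have := hk f (ts ++ [s]) (by rw [apps_concat, e])
      simp only [List.length_append, List.length_cons, List.length_nil] at this
      omega
    · have := h _ f ts (e ▸ (Subterm.refl s).app_right t)
      omega
  | lam t ih =>
    refine ih (fun W f ts hs => h W f ts hs.lam) fun f ts e => ?_
    have := h _ f ts (e ▸ (Subterm.refl t).lam)
    omega

theorem arityCompliant_iff {ar : F → ℕ} {V : Type v} {t : Term F V} :
    t.ArityCompliant ar ↔ t.CompliantAt ar 0 := by
  refine ⟨fun h => h.compliantAt fun f ts e => ?_, fun h W f ts hs => ?_⟩
  · have := h _ f ts (e ▸ Subterm.refl t)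
    omega
  · have := (compliantAt_apps.1 (h.subterm hs)).1
    simpa [CompliantAt] using this

/-! ### Algebraic terms and their instances -/

theorem Algebraic.app_left {V : Type v} {t s : Term F V} (h : (app t s).Algebraic) :
    t.Algebraic :=
  ⟨fun W a ha => h.1 W a (ha.app_left s), fun W x a ha => h.2 W x a (ha.app_left s)⟩

theorem Algebraic.app_right {V : Type v} {t s : Term F V} (h : (app t s).Algebraic) :
    s.Algebraic :=
  ⟨fun W a ha => h.1 W a (ha.app_right t), fun W x a ha => h.2 W x a (ha.app_right t)⟩

theorem Algebraic.app_ne_var {V : Type v} {t s : Term F V} (h : (app t s).Algebraic) (x : V) :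
    t ≠ var x := by
  rintro rfl
  exact h.2 V x s (Subterm.refl _)

theorem not_algebraic_lam {V : Type v} (t : Term F (Option V)) : ¬ (lam t).Algebraic :=
  fun h => h.1 V t (Subterm.refl _)

theorem Algebraic.of_mem_apps {V : Type v} {h : Term F V} {ts : List (Term F V)}
    (ha : (apps h ts).Algebraic) {t : Term F V} (ht : t ∈ ts) : t.Algebraic := by
  induction ts using List.reverseRecOn with
  | nil => simp at ht
  | append_singleton ts s ih =>
    rw [apps_concat] at ha
    rcases List.mem_append.1 ht with ht | ht
    · exact ih ha.app_left ht
    · rw [List.mem_singleton.1 ht]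
      exact ha.app_right

theorem mem_FV_apps_sym {V : Type v} {f : F} {ts : List (Term F V)} {x : V}
    (hx : x ∈ (apps (sym f) ts).FV) : ∃ t ∈ ts, x ∈ t.FV := by
  induction ts using List.reverseRecOn with
  | nil => exact hx.elim
  | append_singleton ts s ih =>
    rw [apps_concat] at hx
    rcases hx with hx | hx
    · obtain ⟨t, ht, hxt⟩ := ih hx
      exact ⟨t, List.mem_append_left _ ht, hxt⟩
    · exact ⟨s, by simp, hx⟩

/-- Variables of an algebraic term are never applied, so a substituted term gains no arguments,
unless `d` is itself a variable; `hv` then forces `k = 0`. -/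
theorem Algebraic.compliantAt_subst {ar : F → ℕ} {V W : Type v} {d : Term F V}
    (hd : d.Algebraic) {θ : V → Term F W} (hθ : ∀ x ∈ d.FV, (θ x).CompliantAt ar 0) {k : ℕ}
    (hk : d.CompliantAt ar k) (hv : ∀ x, d = var x → k = 0) :
    (d.subst θ).CompliantAt ar k := by
  induction d generalizing k with
  | sym f => exact hk
  | var x =>
    rw [hv x rfl]
    exact hθ x rfl
  | app t s iht ihs =>
    exact ⟨iht hd.app_left (fun x hx => hθ x (Or.inl hx)) hk.1
        fun x e => absurd e (hd.app_ne_var x),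
      ihs hd.app_right (fun x hx => hθ x (Or.inr hx)) hk.2 fun _ _ => rfl⟩
  | lam t _ => exact absurd hd (not_algebraic_lam t)

theorem Algebraic.compliantAt_of_subst {ar : F → ℕ} {V W : Type v} {d : Term F V}
    (hd : d.Algebraic) {θ : V → Term F W} {k : ℕ} (hk : (d.subst θ).CompliantAt ar k) {x : V}
    (hx : x ∈ d.FV) : (θ x).CompliantAt ar 0 := by
  induction d generalizing k with
  | sym f => exact hx.elim
  | var y =>
    cases hx
    exact hk.mono k.zero_le
  | app t s iht ihs =>
    rcases hx with hx | hx
    exacts [iht hd.app_left hk.1 hx, ihs hd.app_right hk.2 hx]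
  | lam t _ => exact absurd hd (not_algebraic_lam t)

/-! ### Weak head reduction -/

/-- Weak head reduction. -/
inductive HeadStep {V : Type v} : Term F V → Term F V → Prop where
  | beta (a : Term F (Option V)) (b : Term F V) : HeadStep (app (lam a) b) (a.inst b)
  | app {s t : Term F V} (u : Term F V) : HeadStep s t → HeadStep (app s u) (app t u)

theorem HeadStep.not_lam {V : Type v} {a : Term F (Option V)} {t : Term F V} :
    ¬ HeadStep (lam a) t := nofun

theorem Atomic.not_headStep_apps {V : Type v} {h : Term F V} (hh : h.Atomic)
    (ts : List (Term F V)) (t : Term F V) : ¬ HeadStep (apps h ts) t := by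
  induction ts using List.reverseRecOn generalizing t with
  | nil => cases hh <;> exact nofun
  | append_singleton ts s ih =>
    rw [apps_concat]
    intro H
    generalize e : apps h ts = a at H ih
    cases H with
    | beta => exact hh.apps_ne_lam _ _ e
    | app _ H => exact ih _ H

theorem HeadStep.eq {V : Type v} {s t t' : Term F V} (h : HeadStep s t) (h' : HeadStep s t') :
    t = t' := by
  induction h generalizing t' with
  | beta a b =>
    cases h' with
    | beta => rfl
    | app _ h' => exact absurd h' HeadStep.not_lam
  | app u h ih =>
    cases h' with
    | beta => exact absurd h HeadStep.not_lam
    | app _ h' => rw [ih h']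

theorem HeadStep.subst {V W : Type v} {s t : Term F V} (h : HeadStep s t) (σ : V → Term F W) :
    HeadStep (s.subst σ) (t.subst σ) := by
  induction h with
  | beta a b =>
    rw [inst_subst]
    exact .beta _ _
  | app u _ ih => exact .app _ ih

theorem HeadStep.beta_step {V : Type v} {s t : Term F V} (h : HeadStep s t) : Beta F V s t := by
  induction h with
  | beta a b => exact .base (.mk a b)
  | app u _ ih => exact .app_left u ih

/-- Reflexive and transitive closure of weak head reduction. -/
abbrev HeadSteps {V : Type v} : Term F V → Term F V → Prop := Relation.ReflTransGen HeadStep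

theorem HeadSteps.app {V : Type v} {s t : Term F V} (h : HeadSteps s t) (u : Term F V) :
    HeadSteps (Term.app s u) (Term.app t u) :=
  reflTransGen_map (fun s => Term.app s u) (fun _ _ => HeadStep.app u) h

theorem HeadSteps.subst {V W : Type v} {s t : Term F V} (h : HeadSteps s t)
    (σ : V → Term F W) : HeadSteps (s.subst σ) (t.subst σ) :=
  reflTransGen_map (Term.subst σ) (fun _ _ h => h.subst σ) h

/-! ### Leftmost normalisation -/

/-- `NormAt k s n`: leftmost reduction takes `s` to its beta-normal form `n`, with a derivation of
height at most `k`. -/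
def NormAt : ℕ → ∀ {V : Type v}, Term F V → Term F V → Prop
  | 0, _, _, _ => False
  | k + 1, _, s, n =>
    (∃ h ts ns, h.Atomic ∧ s = apps h ts ∧ n = apps h ns ∧
      List.Forall₂ (fun t m => NormAt k t m) ts ns) ∨
    (∃ a m, s = lam a ∧ n = lam m ∧ NormAt k a m) ∨
    ∃ s', HeadStep s s' ∧ NormAt k s' n

/-- Leftmost reduction takes `s` to its beta-normal form `n`. -/
def Norm {V : Type v} (s n : Term F V) : Prop := ∃ k, NormAt k s n

theorem NormAt.succ {k : ℕ} {V : Type v} {s n : Term F V} (h : NormAt k s n) :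
    NormAt (k + 1) s n := by
  induction k generalizing V with
  | zero => exact h.elim
  | succ k ih =>
    rcases h with ⟨h, ts, ns, hh, rfl, rfl, H⟩ | ⟨a, m, rfl, rfl, H⟩ | ⟨s', hs, H⟩
    · exact Or.inl ⟨h, ts, ns, hh, rfl, rfl, H.imp fun _ _ => ih⟩
    · exact Or.inr (Or.inl ⟨a, m, rfl, rfl, ih H⟩)
    · exact Or.inr (Or.inr ⟨s', hs, ih H⟩)

theorem NormAt.mono {j k : ℕ} (hjk : j ≤ k) {V : Type v} {s n : Term F V} (h : NormAt j s n) :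
    NormAt k s n := by
  induction hjk with
  | refl => exact h
  | step _ ih => exact ih.succ

/-- The three clauses of `NormAt` exclude one another, and head reduction is deterministic. -/
theorem NormAt.eq {j k : ℕ} {V : Type v} {s n n' : Term F V} (h : NormAt j s n)
    (h' : NormAt k s n') : n = n' := by
  induction j generalizing V k with
  | zero => exact h.elim
  | succ j ih =>
    cases k with
    | zero => exact h'.elim
    | succ k =>
      rcases h with ⟨h, ts, ns, hh, rfl, rfl, H⟩ | ⟨a, m, rfl, rfl, H⟩ | ⟨s', hs, H⟩
      · rcases h' with ⟨h', ts', ns', hh', e, rfl, H'⟩ | ⟨a, m, e, _⟩ | ⟨s', hs, _⟩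
        · obtain ⟨rfl, rfl⟩ := hh.apps_inj hh' e
          congr 1
          clear e
          induction H generalizing ns' with
          | nil => cases H'; rfl
          | cons h1 _ ih1 =>
            cases H' with
            | cons h2 H2 => rw [ih h1 h2, ih1 _ H2]
        · exact absurd e (hh.apps_ne_lam _ _)
        · exact absurd hs (hh.not_headStep_apps _ _)
      · rcases h' with ⟨h', ts', ns', hh', e, rfl, H'⟩ | ⟨a', m', e, rfl, H'⟩ | ⟨s', hs, _⟩
        · exact absurd e.symm (hh'.apps_ne_lam _ _)
        · injection e with _ e
          subst e
          rw [ih H H']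
        · exact absurd hs HeadStep.not_lam
      · rcases h' with ⟨h', ts', ns', hh', rfl, rfl, H'⟩ | ⟨a, m, rfl, _⟩ | ⟨s'', hs', H'⟩
        · exact absurd hs (hh'.not_headStep_apps _ _)
        · exact absurd hs HeadStep.not_lam
        · cases hs.eq hs'
          exact ih H H'

theorem Norm.eq {V : Type v} {s n n' : Term F V} (h : Norm s n) (h' : Norm s n') : n = n' := by
  obtain ⟨j, h⟩ := h
  obtain ⟨k, h'⟩ := h'
  exact h.eq h'

theorem Norm.lam {V : Type v} {a m : Term F (Option V)} (h : Norm a m) :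
    Norm (lam a) (lam m) := by
  obtain ⟨k, h⟩ := h
  exact ⟨k + 1, Or.inr (Or.inl ⟨a, m, rfl, rfl, h⟩)⟩

theorem Norm.headSteps {V : Type v} {s t n : Term F V} (h : HeadSteps s t) (hn : Norm t n) :
    Norm s n := by
  induction h using Relation.ReflTransGen.head_induction_on with
  | refl => exact hn
  | head hs _ ih =>
    obtain ⟨k, ih⟩ := ih
    exact ⟨k + 1, Or.inr (Or.inr ⟨_, hs, ih⟩)⟩

theorem exists_normAt_forall₂ {V : Type v} {ts ns : List (Term F V)}
    (H : List.Forall₂ Norm ts ns) : ∃ k, List.Forall₂ (fun t m => NormAt k t m) ts ns := by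
  induction H with
  | nil => exact ⟨0, .nil⟩
  | cons h _ ih =>
    obtain ⟨j, h⟩ := h
    obtain ⟨k, ih⟩ := ih
    exact ⟨max j k, .cons (h.mono (le_max_left _ _))
      (ih.imp fun _ _ h => h.mono (le_max_right _ _))⟩

theorem Norm.apps {V : Type v} {h : Term F V} (hh : h.Atomic) {ts ns : List (Term F V)}
    (H : List.Forall₂ Norm ts ns) : Norm (apps h ts) (apps h ns) := by
  obtain ⟨k, H⟩ := exists_normAt_forall₂ H
  exact ⟨k + 1, Or.inl ⟨h, ts, ns, hh, rfl, rfl, H⟩⟩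

theorem NormAt.betas {k : ℕ} {V : Type v} {s n : Term F V} (h : NormAt k s n) :
    Relation.ReflTransGen (Beta F V) s n := by
  induction k generalizing V with
  | zero => exact h.elim
  | succ k ih =>
    rcases h with ⟨h, ts, ns, hh, rfl, rfl, H⟩ | ⟨a, m, rfl, rfl, H⟩ | ⟨s', hs, H⟩
    · clear hh
      induction H generalizing h with
      | nil => exact .refl
      | @cons t m ts ns h1 _ ih1 =>
        refine (ih1 (Term.app h t)).trans ?_
        refine reflTransGen_map (fun t => Term.apps (Term.app h t) ns)
          (fun a b hab => ?_) (ih h1)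
        have : Beta F V (Term.app h a) (Term.app h b) := .app_right _ hab
        clear * - this
        generalize Term.app h a = p at this ⊢
        generalize Term.app h b = q at this ⊢
        induction ns generalizing p q with
        | nil => exact this
        | cons n ns ih => exact ih _ _ (.app_left n this)
    · exact reflTransGen_map Term.lam (fun _ _ => .lam) (ih H)
    · exact .head hs.beta_step (ih H)

theorem NormAt.apps_inv {k : ℕ} {V : Type v} {h n : Term F V} {ts : List (Term F V)}
    (hh : h.Atomic) (H : NormAt (k + 1) (apps h ts) n) :
    ∃ ns, n = apps h ns ∧ List.Forall₂ (fun t m => NormAt k t m) ts ns := by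
  rcases H with ⟨h', ts', ns', hh', e, rfl, H'⟩ | ⟨a', m', e, _⟩ | ⟨s', hs, _⟩
  · obtain ⟨rfl, rfl⟩ := hh.apps_inj hh' e
    exact ⟨ns', rfl, H'⟩
  · exact absurd e (hh.apps_ne_lam _ _)
  · exact absurd hs (hh.not_headStep_apps _ _)

theorem NormAt.exists_apps {k : ℕ} {V : Type v} {s n : Term F V} (H : NormAt k s n)
    (hn : ∀ a, n ≠ Term.lam a) : ∃ h ts ns, h.Atomic ∧ HeadSteps s (Term.apps h ts) ∧
      n = Term.apps h ns ∧ List.Forall₂ Norm ts ns := by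
  induction k generalizing s with
  | zero => exact H.elim
  | succ k ih =>
    rcases H with ⟨h, ts, ns, hh, rfl, rfl, H⟩ | ⟨a, m, rfl, rfl, H⟩ | ⟨s', hs, H⟩
    · exact ⟨h, ts, ns, hh, .refl, rfl, H.imp fun _ _ h => ⟨k, h⟩⟩
    · exact absurd rfl (hn m)
    · obtain ⟨h, ts, ns, hh, h1, h2, h3⟩ := ih H
      exact ⟨h, ts, ns, hh, .head hs h1, h2, h3⟩

/-- As `m` is not an abstraction, head reduction of `s` ends in a spine with atomic head, and `t`
just becomes its last argument; no redex is created. -/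
theorem Norm.app {V : Type v} {s t m n : Term F V} (hs : Norm s m) (hm : ∀ a, m ≠ Term.lam a)
    (ht : Norm t n) : Norm (Term.app s t) (Term.app m n) := by
  obtain ⟨k, hs⟩ := hs
  obtain ⟨h, ts, ns, hh, h1, rfl, H⟩ := hs.exists_apps hm
  refine Norm.headSteps (h1.app t) ?_
  rw [← apps_concat, ← apps_concat]
  exact Norm.apps hh (List.rel_append H (.cons ht .nil))

theorem Algebraic.exists_sym_apps {V : Type v} {d : Term F V} (hd : d.Algebraic)
    (hv : ∀ x, d ≠ var x) : ∃ f ds, d = Term.apps (sym f) ds := by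
  induction d with
  | sym f => exact ⟨f, [], rfl⟩
  | var x => exact absurd rfl (hv x)
  | app t s iht ihs =>
    obtain ⟨f, ds, rfl⟩ := iht hd.app_left hd.app_ne_var
    exact ⟨f, ds ++ [s], (apps_concat _ _ _).symm⟩
  | lam t _ => exact absurd hd (not_algebraic_lam t)

/-- The function part of an application in `d` is headed by a symbol, so no instance of it
normalises to an abstraction. -/
theorem Algebraic.norm_subst {V W : Type v} {d : Term F V} (hd : d.Algebraic)
    {σ θ : V → Term F W} (H : ∀ x ∈ d.FV, Norm (σ x) (θ x)) :
    Norm (d.subst σ) (d.subst θ) := by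
  induction d with
  | sym f => exact Norm.apps (ts := []) (ns := []) (.sym f) .nil
  | var x => exact H x rfl
  | app t s iht ihs =>
    refine Norm.app (iht hd.app_left fun x hx => H x (Or.inl hx)) (fun a => ?_)
      (ihs hd.app_right fun x hx => H x (Or.inr hx))
    obtain ⟨f, ds, rfl⟩ := hd.app_left.exists_sym_apps hd.app_ne_var
    rw [apps_subst]
    exact Atomic.apps_ne_lam (.sym f) _ _
  | lam t _ => exact absurd hd (not_algebraic_lam t)

/-- A derivation for `d.subst σ` follows the symbol spines of `d` and contains one for `σ x`.
Heights are kept because the projection is proved by induction on them. -/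
theorem Algebraic.normAt_of_subst {k : ℕ} {V W : Type v} {d : Term F V} (hd : d.Algebraic)
    {σ : V → Term F W} {n : Term F W} (H : NormAt k (d.subst σ) n) {x : V} (hx : x ∈ d.FV) :
    ∃ m, NormAt k (σ x) m := by
  induction d generalizing n with
  | sym f => exact hx.elim
  | var y =>
    cases hx
    exact ⟨n, H⟩
  | app t s iht ihs =>
    cases k with
    | zero => exact H.elim
    | succ k =>
      obtain ⟨f, ds, rfl⟩ := hd.app_left.exists_sym_apps hd.app_ne_var
      have e : (Term.app (Term.apps (sym f) ds) s).subst σ =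
          Term.apps (sym f) (ds.map (Term.subst σ) ++ [s.subst σ]) := by
        rw [apps_concat, Term.subst, apps_subst]
        rfl
      rw [e] at H
      obtain ⟨ns, -, H⟩ := H.apps_inv (.sym f)
      -- Splitting off the last argument gives back a derivation for the instance of the function
      -- part, of the same height.
      have h1 := List.forall₂_take (ds.map (Term.subst σ)).length H
      have h2 := List.forall₂_drop (ds.map (Term.subst σ)).length H
      rw [List.take_left] at h1
      rw [List.drop_left] at h2
      generalize ns.drop _ = ns2 at h2
      rcases hx with hx | hx
      · refine iht hd.app_left (n := Term.apps (sym f) (ns.take (ds.map (Term.subst σ)).length)) ?_ hx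
        rw [apps_subst]
        exact Or.inl ⟨_, _, _, .sym f, rfl, rfl, h1⟩
      · cases h2 with
        | cons h2 _ => exact ihs hd.app_right h2.succ hx
  | lam t _ => exact absurd hd (not_algebraic_lam t)

/-! ### Standardisation of beta-reduction -/

/-- Compatible closure of the contraction of beta-redexes. -/
inductive BetaStep : {V : Type v} → Term F V → Term F V → Prop where
  | beta {V : Type v} (a : Term F (Option V)) (b : Term F V) :
      BetaStep (app (lam a) b) (a.inst b)
  | lam {V : Type v} {a b : Term F (Option V)} : BetaStep a b → BetaStep (lam a) (lam b)
  | app_left {V : Type v} {s t : Term F V} (u : Term F V) :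
      BetaStep s t → BetaStep (app s u) (app t u)
  | app_right {V : Type v} (u : Term F V) {s t : Term F V} :
      BetaStep s t → BetaStep (app u s) (app u t)

theorem BetaStep.subst {V W : Type v} {s t : Term F V} (h : BetaStep s t)
    (σ : V → Term F W) : BetaStep (s.subst σ) (t.subst σ) := by
  induction h generalizing W with
  | beta a b =>
    rw [inst_subst]
    exact .beta _ _
  | lam _ ih => exact .lam (ih _)
  | app_left u _ ih => exact .app_left _ (ih σ)
  | app_right u _ ih => exact .app_right _ (ih σ)

/-- Contraction is stable under substitution, so the closure under substitution adds no steps;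
without that constructor, induction follows the position of the redex. -/
theorem betaStep_of_beta {V : Type v} {s t : Term F V} (h : Beta F V s t) : BetaStep s t := by
  induction h with
  | base h =>
    cases h
    exact .beta _ _
  | lam _ ih => exact .lam ih
  | app_left u _ ih => exact .app_left u ih
  | app_right u _ ih => exact .app_right u ih
  | subst σ _ ih => exact ih.subst σ

/-- Standard beta-reduction sequences: weak head steps first, then standard sequences in the
immediate subterms. -/
inductive Std : {V : Type v} → Term F V → Term F V → Prop where
  | sym {V : Type v} {s : Term F V} (f : F) : HeadSteps s (sym f) → Std s (sym f)
  | var {V : Type v} {s : Term F V} (x : V) : HeadSteps s (var x) → Std s (var x)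
  | app {V : Type v} {s a b a' b' : Term F V} :
      HeadSteps s (app a b) → Std a a' → Std b b' → Std s (app a' b')
  | lam {V : Type v} {s : Term F V} {a a' : Term F (Option V)} :
      HeadSteps s (lam a) → Std a a' → Std s (lam a')

theorem Std.refl {V : Type v} (t : Term F V) : Std t t := by
  induction t with
  | sym f => exact .sym f .refl
  | var x => exact .var x .refl
  | app t s iht ihs => exact .app .refl iht ihs
  | lam t ih => exact .lam .refl ih

theorem Std.headSteps {V : Type v} {s s' t : Term F V} (hs : HeadSteps s s') (h : Std s' t) :
    Std s t := by
  cases h with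
  | sym f h => exact .sym f (hs.trans h)
  | var x h => exact .var x (hs.trans h)
  | app h h1 h2 => exact .app (hs.trans h) h1 h2
  | lam h h1 => exact .lam (hs.trans h) h1

theorem Std.rename {V W : Type v} {s t : Term F V} (h : Std s t) (ρ : V → W) :
    Std (s.rename ρ) (t.rename ρ) := by
  have key {V W : Type v} {s t : Term F V} (h : HeadSteps s t) (ρ : V → W) :
      HeadSteps (s.rename ρ) (t.rename ρ) := by
    rw [rename_eq_subst, rename_eq_subst]
    exact HeadSteps.subst h _
  induction h generalizing W with
  | sym f h => exact .sym f (key h ρ)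
  | var x h => exact .var _ (key h ρ)
  | app h _ _ ih1 ih2 => exact .app (key h ρ) (ih1 ρ) (ih2 ρ)
  | lam h _ ih => exact .lam (key h ρ) (ih _)

theorem Std.subst {V W : Type v} {s t : Term F V} (h : Std s t) {σ τ : V → Term F W}
    (H : ∀ x, Std (σ x) (τ x)) : Std (s.subst σ) (t.subst τ) := by
  induction h generalizing W with
  | sym f h => exact .sym f (HeadSteps.subst h σ)
  | var x h => exact Std.headSteps (HeadSteps.subst h σ) (H x)
  | app h _ _ ih1 ih2 => exact .app (HeadSteps.subst h σ) (ih1 H) (ih2 H)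
  | lam h _ ih =>
    refine .lam (HeadSteps.subst h σ) (ih fun o => ?_)
    cases o with
    | none => exact Std.refl _
    | some x => exact (H x).rename some

theorem Std.inst {V : Type v} {a a' : Term F (Option V)} {b b' : Term F V} (ha : Std a a')
    (hb : Std b b') : Std (a.inst b) (a'.inst b') := by
  refine ha.subst fun o => ?_
  cases o with
  | none => exact hb
  | some x => exact Std.refl _

/-- A step at the end is absorbed at its position. If it contracts a root redex, the head steps
leading to that redex and its contraction join the initial head phase, and the standard sequences of
body and argument combine by `Std.inst`. -/
theorem Std.betaStep {V : Type v} {s t u : Term F V} (h : Std s t) (hb : BetaStep t u) :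
    Std s u := by
  induction hb with
  | beta a b =>
    cases h with
    | app h h1 h2 =>
      cases h1 with
      | lam h3 h4 =>
        exact Std.headSteps ((h.trans (HeadSteps.app h3 _)).tail (.beta _ _)) (h4.inst h2)
  | lam _ ih =>
    cases h with
    | lam h h1 => exact .lam h (ih h1)
  | app_left u _ ih =>
    cases h with
    | app h h1 h2 => exact .app h (ih h1) h2
  | app_right u _ ih =>
    cases h with
    | app h h1 h2 => exact .app h h1 (ih h2)

/-- In a normal application the function part is not an abstraction, so `Norm.app` assembles the
leftmost derivation. -/
theorem Std.norm {V : Type v} {s n : Term F V} (h : Std s n) (hn : ∀ m, ¬ Beta F V n m) :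
    Norm s n := by
  induction h with
  | sym f h => exact Norm.headSteps h (Norm.apps (ts := []) (ns := []) (.sym f) .nil)
  | var x h => exact Norm.headSteps h (Norm.apps (ts := []) (ns := []) (.var x) .nil)
  | app h _ _ ih1 ih2 =>
    refine Norm.headSteps h (Norm.app (ih1 fun m hm => hn _ (.app_left _ hm)) (fun a e => ?_)
      (ih2 fun m hm => hn _ (.app_right _ hm)))
    subst e
    exact hn _ (.base (.mk _ _))
  | lam h _ ih => exact Norm.headSteps h (Norm.lam (ih fun m hm => hn _ (.lam hm)))

/-- Leftmost reduction reaches the beta-normal form. -/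
theorem norm_of_isBetaNormalForm {V : Type v} {s n : Term F V} (h : IsBetaNormalForm s n) :
    Norm s n := by
  have std {t : Term F V} (ht : Relation.ReflTransGen (Beta F V) s t) : Std s t := by
    induction ht with
    | refl => exact Std.refl s
    | tail _ hb ih => exact ih.betaStep (betaStep_of_beta hb)
  exact (std h.1).norm h.2

end Term

open Term

variable {F : Type u} {X : Type v}

/-! ### Parallel reduction -/

/-- Nested parallel reduction for beta and the rules of `R`, whose conditions are evaluated with
`A` before the reduction of the substitution. -/
inductive Par (R : Set (Rule F X)) (A : Rel.{u, v} F) :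
    {V : Type v} → Term F V → Term F V → Prop where
  | sym {V : Type v} (f : F) : Par R A (sym f : Term F V) (sym f)
  | var {V : Type v} (x : V) : Par R A (var x) (var x)
  | app {V : Type v} {s s' t t' : Term F V} :
      Par R A s s' → Par R A t t' → Par R A (app s t) (app s' t')
  | lam {V : Type v} {a a' : Term F (Option V)} : Par R A a a' → Par R A (lam a) (lam a')
  | beta {V : Type v} {a a' : Term F (Option V)} {b b' : Term F V} :
      Par R A a a' → Par R A b b' → Par R A (app (lam a) b) (a'.inst b')
  | rule {V : Type v} (ρ : Rule F X) {σ σ' : X → Term F V} (hρ : ρ ∈ R)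
      (hσ : ∀ p ∈ ρ.conds, Joinable (A V) (p.1.subst σ) (p.2.subst σ)) :
      (∀ x, Par R A (σ x) (σ' x)) → Par R A (ρ.lhs.subst σ) (ρ.rhs.subst σ')

/-- Closure of a relation under substitution. -/
def SubstClosed (A : Rel.{u, v} F) : Prop :=
  ∀ (V W : Type v) (s t : Term F V) (σ : V → Term F W), A V s t → A W (s.subst σ) (t.subst σ)

theorem SubstClosed.joinable {A : Rel.{u, v} F} (hA : SubstClosed A) {V W : Type v}
    {s t : Term F V} (h : Joinable (A V) s t) (σ : V → Term F W) :
    Joinable (A W) (s.subst σ) (t.subst σ) := by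
  obtain ⟨w, h1, h2⟩ := h
  exact ⟨w.subst σ, reflTransGen_map (Term.subst σ) (fun _ _ => hA _ _ _ _ σ) h1,
    reflTransGen_map (Term.subst σ) (fun _ _ => hA _ _ _ _ σ) h2⟩

namespace Par

variable {R : Set (Rule F X)} {A : Rel.{u, v} F}

theorem refl {V : Type v} (t : Term F V) : Par R A t t := by
  induction t with
  | sym f => exact .sym f
  | var x => exact .var x
  | app t s iht ihs => exact .app iht ihs
  | lam t ih => exact .lam ih

theorem rename (hA : SubstClosed A) {V W : Type v} {s t : Term F V} (h : Par R A s t)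
    (ρ : V → W) : Par R A (s.rename ρ) (t.rename ρ) := by
  induction h generalizing W with
  | sym f => exact .sym f
  | var x => exact .var _
  | app _ _ ih1 ih2 => exact .app (ih1 ρ) (ih2 ρ)
  | lam _ ih => exact .lam (ih _)
  | beta _ _ ih1 ih2 =>
    rw [inst_rename]
    exact .beta (ih1 _) (ih2 ρ)
  | rule r hr hσ _ ih =>
    rw [rename_subst, rename_subst]
    refine .rule r hr (fun p hp => ?_) fun x => ih x ρ
    rw [← rename_subst, ← rename_subst, rename_eq_subst, rename_eq_subst]
    exact hA.joinable (hσ p hp) _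

/-- Conditions are evaluated on the source of a parallel step, so only σ acts on them, and stability
of `A` under substitution suffices. -/
theorem subst (hA : SubstClosed A) {V W : Type v} {s t : Term F V} (h : Par R A s t)
    {σ τ : V → Term F W} (H : ∀ x, Par R A (σ x) (τ x)) :
    Par R A (s.subst σ) (t.subst τ) := by
  have lift {V W : Type v} {σ τ : V → Term F W} (H : ∀ x, Par R A (σ x) (τ x)) (o : Option V) :
      Par R A (liftSubst σ o) (liftSubst τ o) := by
    cases o with
    | none => exact .var _
    | some x => exact (H x).rename hA some
  induction h generalizing W with
  | sym f => exact .sym f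
  | var x => exact H x
  | app _ _ ih1 ih2 => exact .app (ih1 H) (ih2 H)
  | lam _ ih => exact .lam (ih (lift H))
  | beta _ _ ih1 ih2 =>
    rw [inst_subst]
    exact .beta (ih1 (lift H)) (ih2 H)
  | rule r hr hσ _ ih =>
    rw [subst_subst, subst_subst]
    refine .rule r hr (fun p hp => ?_) fun x => ih x H
    rw [← subst_subst, ← subst_subst]
    exact hA.joinable (hσ p hp) _

theorem inst (hA : SubstClosed A) {V : Type v} {a a' : Term F (Option V)} {b b' : Term F V}
    (ha : Par R A a a') (hb : Par R A b b') : Par R A (a.inst b) (a'.inst b') := by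
  refine ha.subst hA fun o => ?_
  cases o with
  | none => exact hb
  | some x => exact Par.refl _

theorem of_condStep (hA : SubstClosed A) {V : Type v} {s t : Term F V}
    (h : RewriteClosure (RuleInstance R A) V s t) : Par R A s t := by
  induction h with
  | base h =>
    cases h with
    | mk r σ hr hσ => exact .rule r hr hσ fun x => Par.refl _
  | lam _ ih => exact .lam ih
  | app_left u _ ih => exact .app ih (.refl u)
  | app_right u _ ih => exact .app (.refl u) ih
  | subst σ _ ih => exact ih.subst hA fun x => .refl _

theorem of_beta {V : Type v} {s t : Term F V} (h : Beta F V s t) : Par R A s t := by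
  replace h := betaStep_of_beta h
  induction h with
  | beta a b => exact .beta (.refl a) (.refl b)
  | lam _ ih => exact .lam ih
  | app_left u _ ih => exact .app ih (.refl u)
  | app_right u _ ih => exact .app (.refl u) ih

variable {ar : F → ℕ}

theorem _root_.LamRew.Rule.ArityCompliant.exists_lhs_subst {ρ : Rule F X} (h : ρ.ArityCompliant ar)
    {V : Type v} (σ : X → Term F V) : ∃ f ts, ρ.lhs.subst σ = apps (Term.sym f) ts ∧
      ts.length = ar f := by
  obtain ⟨f, ls, h1, h2⟩ := h.2.2.1
  refine ⟨f, ls.map (Term.subst σ), ?_, by simpa using h2⟩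
  rw [h1, apps_subst]
  rfl

theorem lam_inv (hR : ∀ ρ ∈ R, ρ.ArityCompliant ar) {V : Type v} {a : Term F (Option V)}
    {t : Term F V} (h : Par R A (Term.lam a) t) : ∃ a', t = Term.lam a' ∧ Par R A a a' := by
  generalize e : Term.lam a = s at h
  cases h with
  | lam h =>
    cases e
    exact ⟨_, rfl, h⟩
  | @rule _ r σ _ hr _ _ =>
    obtain ⟨f, ts, h1, -⟩ := (hR r hr).exists_lhs_subst σ
    rw [h1] at e
    exact absurd e.symm (Atomic.apps_ne_lam (.sym f) _ _)
  | _ => cases e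

/-- Left-hand sides are symbol spines, so no rule applies at the root of a term with a head step.
The parallel step either contracts the same head redex, and `t` does not move, or preserves it, and
`t` contracts it. -/
theorem headStep (hA : SubstClosed A) (hR : ∀ ρ ∈ R, ρ.ArityCompliant ar) {V : Type v}
    {s s' t : Term F V} (hs : HeadStep s s') (h : Par R A s t) :
    ∃ t', HeadSteps t t' ∧ Par R A s' t' := by
  induction hs generalizing t with
  | beta a b =>
    have hb := HeadStep.beta a b
    generalize e : Term.app (Term.lam a) b = s at h hb
    cases h with
    | app h1 h2 =>
      cases e
      obtain ⟨a', rfl, h3⟩ := lam_inv hR h1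
      exact ⟨_, .single (.beta _ _), h3.inst hA h2⟩
    | beta h1 h2 =>
      cases e
      exact ⟨_, .refl, h1.inst hA h2⟩
    | @rule _ r σ _ hr _ _ =>
      obtain ⟨f, ts, h1, -⟩ := (hR r hr).exists_lhs_subst σ
      rw [h1] at hb
      exact absurd hb (Atomic.not_headStep_apps (.sym f) _ _)
    | _ => cases e
  | @app p q u hs ih =>
    have hb := HeadStep.app u hs
    generalize e : Term.app p u = s at h hb
    cases h with
    | app h1 h2 =>
      cases e
      obtain ⟨t', h3, h4⟩ := ih h1
      exact ⟨_, HeadSteps.app h3 _, .app h4 h2⟩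
    | beta h1 h2 =>
      cases e
      exact absurd hs HeadStep.not_lam
    | @rule _ r σ _ hr _ _ =>
      obtain ⟨f, ts, h1, -⟩ := (hR r hr).exists_lhs_subst σ
      rw [h1] at hb
      exact absurd hb (Atomic.not_headStep_apps (.sym f) _ _)
    | _ => cases e

/-- A parallel step from a compliant spine either acts inside the arguments or contracts the whole
spine by a rule. -/
theorem apps_inv (hR : ∀ ρ ∈ R, ρ.ArityCompliant ar) {V : Type v} {h t : Term F V}
    {ts : List (Term F V)} (hh : h.Atomic) (hc : h.CompliantAt ar ts.length)
    (H : Par R A (apps h ts) t) :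
    (∃ ts', t = apps h ts' ∧ List.Forall₂ (Par R A) ts ts') ∨
    ∃ ρ ∈ R, ∃ σ σ' : X → Term F V, apps h ts = ρ.lhs.subst σ ∧ t = ρ.rhs.subst σ' ∧
      (∀ p ∈ ρ.conds, Joinable (A V) (p.1.subst σ) (p.2.subst σ)) ∧
      ∀ x, Par R A (σ x) (σ' x) := by
  induction ts using List.reverseRecOn generalizing t with
  | nil =>
    change Par R A h t at H
    cases H with
    | rule r hr hσ hp => exact Or.inr ⟨r, hr, _, _, rfl, rfl, hσ, hp⟩
    | sym f => exact Or.inl ⟨[], rfl, .nil⟩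
    | var x => exact Or.inl ⟨[], rfl, .nil⟩
    | _ => cases hh
  | append_singleton ts b ih =>
    rw [apps_concat] at H ⊢
    rw [List.length_append] at hc
    generalize e : Term.app (apps h ts) b = s at H
    cases H with
    | rule r hr hσ hp => exact Or.inr ⟨r, hr, _, _, rfl, rfl, hσ, hp⟩
    | app h1 h2 =>
      cases e
      rcases ih (hc.mono (Nat.le_add_right _ _)) h1 with ⟨ts', rfl, h3⟩ | ⟨r, hr, σ, _, e, _⟩
      · exact Or.inl ⟨ts' ++ [_], (apps_concat _ _ _).symm, List.rel_append h3 (.cons h2 .nil)⟩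
      · obtain ⟨f, us, h1, h2⟩ := (hR r hr).exists_lhs_subst σ
        obtain ⟨rfl, rfl⟩ := hh.apps_inj (.sym f) (e.trans h1)
        -- A rule matching the prefix already uses all `ar f` arguments; the further argument `b`
        -- would exceed the arity.
        have : ts.length + 1 ≤ ar f := hc
        omega
    | beta h1 h2 =>
      injection e with _ e _
      exact absurd e (hh.apps_ne_lam _ _)
    | _ => cases e

end Par

/-! ### Projection on beta-normal forms -/

theorem RewriteClosure.reflTransGen_apps {B : Rel.{u, v} F} {V : Type v} (h : Term F V)
    {ts us : List (Term F V)}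
    (H : List.Forall₂ (Relation.ReflTransGen (RewriteClosure B V)) ts us) :
    Relation.ReflTransGen (RewriteClosure B V) (apps h ts) (apps h us) := by
  have aux {ns : List (Term F V)} {p q : Term F V} (h : RewriteClosure B V p q) :
      RewriteClosure B V (apps p ns) (apps q ns) := by
    induction ns generalizing p q with
    | nil => exact h
    | cons n ns ih => exact ih (.app_left n h)
  induction H generalizing h with
  | nil => exact .refl
  | @cons t m ts ns h1 _ ih =>
    exact (ih (.app h t)).trans (reflTransGen_map (fun t => apps (.app h t) ns)
      (fun a b hab => aux (.app_right h hab)) h1)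

theorem RewriteClosure.reflTransGen_subst {B : Rel.{u, v} F} {V W : Type v} {d : Term F V}
    (hd : d.Algebraic) {σ τ : V → Term F W}
    (H : ∀ x ∈ d.FV, Relation.ReflTransGen (RewriteClosure B W) (σ x) (τ x)) :
    Relation.ReflTransGen (RewriteClosure B W) (d.subst σ) (d.subst τ) := by
  induction d with
  | sym f => exact .refl
  | var x => exact H x rfl
  | app t s iht ihs =>
    exact reflTransGen_apps (ts := [s.subst σ]) (us := [s.subst τ]) _
      (.cons (ihs hd.app_right fun x hx => H x (Or.inr hx)) .nil) |>.trans
      (reflTransGen_map (fun p => Term.app p (s.subst τ)) (fun _ _ => .app_left _)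
        (iht hd.app_left fun x hx => H x (Or.inl hx)))
  | lam t _ => exact absurd hd (not_algebraic_lam t)

/-- `B` lifts to a relation between arity-compliant beta-normal forms included in the reflexive
and transitive closure of `A`. -/
def Projects (ar : F → ℕ) (B A : Rel.{u, v} F) : Prop :=
  ∀ (V : Type v) (s t n : Term F V), B V s t → Norm s n → n.CompliantAt ar 0 →
    ∃ n', Norm t n' ∧ n'.CompliantAt ar 0 ∧ Relation.ReflTransGen (A V) n n'

theorem Projects.reflTransGen {ar : F → ℕ} {B A : Rel.{u, v} F} (h : Projects ar B A)
    {V : Type v} {s t n : Term F V} (hst : Relation.ReflTransGen (B V) s t) (hn : Norm s n)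
    (hc : n.CompliantAt ar 0) :
    ∃ n', Norm t n' ∧ n'.CompliantAt ar 0 ∧ Relation.ReflTransGen (A V) n n' := by
  induction hst with
  | refl => exact ⟨n, hn, hc, .refl⟩
  | tail _ hs ih =>
    obtain ⟨m, h1, h2, h3⟩ := ih
    obtain ⟨n', h4, h5, h6⟩ := h _ _ _ _ hs h1 h2
    exact ⟨n', h4, h5, h3.trans h6⟩

/-- Both sides project to a normal form of the common reduct, and that normal form is unique. -/
theorem Projects.joinable {ar : F → ℕ} {A : Rel.{u, v} F} (h : Projects ar A A)
    {V : Type v} {s t m n : Term F V} (hst : Joinable (A V) s t) (hs : Norm s m)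
    (hm : m.CompliantAt ar 0) (ht : Norm t n) (hn : n.CompliantAt ar 0) :
    Joinable (A V) m n := by
  obtain ⟨w, h1, h2⟩ := hst
  obtain ⟨w1, h3, -, h4⟩ := h.reflTransGen h1 hs hm
  obtain ⟨w2, h5, -, h6⟩ := h.reflTransGen h2 ht hn
  cases h3.eq h5
  exact ⟨w1, h4, h6⟩

/-- Induction on the height of the leftmost derivation of `n`. The parallel step is pushed through a
head step, an abstraction or a spine; in the remaining case a rule contracts the whole spine, and
the same rule is replayed on `n`. -/
theorem Par.projects {ar : F → ℕ} {R : Set (Rule F X)} {A : Rel.{u, v} F}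
    (hR_algebraic : ∀ ρ ∈ R, ρ.Algebraic) (hR_arity : ∀ ρ ∈ R, ρ.ArityCompliant ar)
    (hA : SubstClosed A) (hAA : Projects ar A A) :
    Projects ar (fun _ => Par R A) (RewriteClosure (RuleInstance R A)) := by
  rintro V s t n hst ⟨k, hn⟩ hc
  induction k generalizing V with
  | zero => exact hn.elim
  | succ k ih =>
    have hn0 := hn
    rcases hn with ⟨h, ts, ns, hh, rfl, rfl, H⟩ | ⟨a, m, rfl, rfl, H⟩ | ⟨s', hs, H⟩
    · obtain ⟨hc1, hc2⟩ := compliantAt_apps.1 hc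
      rw [zero_add] at hc1
      rcases hst.apps_inv hR_arity hh (H.length_eq ▸ hc1) with
        ⟨ts', rfl, h3⟩ | ⟨r, hr, σ, σ', e, rfl, hσ, hp⟩
      · obtain ⟨ns', h4, h5, h6⟩ : ∃ ns', List.Forall₂ Norm ts' ns' ∧
            (∀ t ∈ ns', t.CompliantAt ar 0) ∧ List.Forall₂
              (Relation.ReflTransGen (RewriteClosure (RuleInstance R A) V)) ns ns' := by
          clear hc hc1 hst hn0
          induction H generalizing ts' with
          | nil =>
            cases h3
            exact ⟨[], .nil, by simp, .nil⟩
          | cons hm _ ih1 =>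
            cases h3 with
            | cons h1 h2 =>
              obtain ⟨m', g1, g2, g3⟩ := ih _ _ _ _ h1 hm (hc2 _ (by simp))
              obtain ⟨ns', g4, g5, g6⟩ := ih1 (fun t ht => hc2 t (by simp [ht])) _ h2
              refine ⟨m' :: ns', .cons g1 g4, ?_, .cons g3 g6⟩
              rintro t (_ | ⟨_, ht⟩)
              exacts [g2, g5 t ht]
        refine ⟨_, Norm.apps hh h4, compliantAt_apps.2 ⟨?_, h5⟩,
          RewriteClosure.reflTransGen_apps h h6⟩
        rwa [zero_add, ← h6.length_eq]
      · have hlhs := (hR_algebraic r hr).1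
        obtain ⟨f, ls, hl, -⟩ := (hR_arity r hr).2.2.1
        -- Values of θ and θ' outside the variables of the left-hand side are arbitrary; conditions
        -- and right-hand side do not see them.
        have : Nonempty (Term F V) := ⟨h⟩
        -- Each variable lies in an argument of `f`; entering it lowers the height from `k + 1` to
        -- `k`, so the induction hypothesis applies to `σ x`.
        have hσn : ∀ x ∈ r.lhs.FV, ∃ m, NormAt k (σ x) m := by
          intro x hx
          rw [hl] at hx
          obtain ⟨l, hlm, hxl⟩ := mem_FV_apps_sym hx
          rw [e, hl, apps_subst] at hn0
          obtain ⟨ms, -, hms⟩ := hn0.apps_inv (.sym f)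
          rw [List.forall₂_map_left_iff] at hms
          obtain ⟨m, hm⟩ : ∃ m, NormAt k (l.subst σ) m := by
            clear * - hms hlm
            induction hms with
            | nil => simp at hlm
            | cons h1 _ ih =>
              rcases List.mem_cons.1 hlm with rfl | hlm
              exacts [⟨_, h1⟩, ih hlm]
          exact ((hl ▸ hlhs).of_mem_apps hlm).normAt_of_subst hm hxl
        choose! θ hθ using hσn
        -- Uniqueness of normal forms exhibits `n` as an instance of the left-hand side.
        have hnθ : apps h ns = r.lhs.subst θ :=
          Norm.eq ⟨_, hn0⟩ (e ▸ hlhs.norm_subst fun x hx => ⟨k, hθ x hx⟩)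
        have hθc : ∀ x ∈ r.lhs.FV, (θ x).CompliantAt ar 0 := by
          rw [hnθ] at hc
          exact fun x hx => hlhs.compliantAt_of_subst hc hx
        have hθ' : ∀ x ∈ r.lhs.FV, ∃ m, Norm (σ' x) m ∧ m.CompliantAt ar 0 ∧
            Relation.ReflTransGen (RewriteClosure (RuleInstance R A) V) (θ x) m :=
          fun x hx => ih V _ _ _ (hp x) (hθ x hx) (hθc x hx)
        choose! θ' hθ1 hθ2 hθ3 using hθ'
        have hrhs := (hR_algebraic r hr).2.1
        refine ⟨r.rhs.subst θ', hrhs.norm_subst fun x hx => hθ1 x (r.fv_rhs hx),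
          hrhs.compliantAt_subst (fun x hx => hθ2 x (r.fv_rhs hx))
            (arityCompliant_iff.1 (hR_arity r hr).2.1) fun _ _ => rfl, ?_⟩
        rw [hnθ]
        -- The rule is fired at θ, the normal form of the unreduced σ for which the conditions are
        -- known; the steps from θ to θ' come afterwards, inside the contractum.
        refine .head (.base (.mk r θ hr fun p hp => ?_))
          (RewriteClosure.reflTransGen_subst hrhs fun x hx => hθ3 x (r.fv_rhs hx))
        obtain ⟨ha1, ha2⟩ := (hR_algebraic r hr).2.2 p hp
        obtain ⟨hc1, hc2⟩ := (hR_arity r hr).2.2.2 p hp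
        obtain ⟨hf1, hf2⟩ := r.fv_conds p hp
        exact hAA.joinable (hσ p hp) (ha1.norm_subst fun x hx => ⟨k, hθ x (hf1 hx)⟩)
          (ha1.compliantAt_subst (fun x hx => hθc x (hf1 hx)) (arityCompliant_iff.1 hc1)
            fun _ _ => rfl)
          (ha2.norm_subst fun x hx => ⟨k, hθ x (hf2 hx)⟩)
          (ha2.compliantAt_subst (fun x hx => hθc x (hf2 hx)) (arityCompliant_iff.1 hc2)
            fun _ _ => rfl)
    · obtain ⟨a', rfl, ha⟩ := hst.lam_inv hR_arity
      obtain ⟨m', h1, h2, h3⟩ := ih _ _ _ _ ha H hc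
      exact ⟨_, h1.lam, h2, reflTransGen_map Term.lam (fun _ _ => .lam) h3⟩
    · obtain ⟨t', h1, h2⟩ := hst.headStep hA hR_arity hs
      obtain ⟨n', h3, h4⟩ := ih _ _ _ _ h2 H hc
      exact ⟨n', Norm.headSteps h1 h3, h4⟩

theorem substClosed_condStepAt (R : Set (Rule F X)) (i : ℕ) : SubstClosed (CondStepAt R i) := by
  cases i with
  | zero => exact fun _ _ _ _ _ h => h
  | succ i => exact fun _ _ _ _ σ h => .subst σ h

/-- At level `i + 1` the conditions are evaluated at level `i`, where the induction hypothesis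
projects them. -/
theorem projects_condStepAt {ar : F → ℕ} {R : Set (Rule F X)}
    (hR_algebraic : ∀ ρ ∈ R, ρ.Algebraic) (hR_arity : ∀ ρ ∈ R, ρ.ArityCompliant ar) (i : ℕ) :
    Projects ar (CondStepAt R i) (CondStepAt R i) := by
  induction i with
  | zero => exact fun _ _ _ _ h => h.elim
  | succ i ih =>
    exact fun V s t n h => Par.projects hR_algebraic hR_arity (substClosed_condStepAt R i) ih
      V s t n (Par.of_condStep (substClosed_condStepAt R i) h)

/-- A reduction from a term with an arity-compliant beta-normal form projects on a conditional
reduction from this normal form. -/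
theorem projects_betaCondStep {ar : F → ℕ} {R : Set (Rule F X)}
    (hR_algebraic : ∀ ρ ∈ R, ρ.Algebraic) (hR_arity : ∀ ρ ∈ R, ρ.ArityCompliant ar) :
    Projects ar (BetaCondStep R) (CondStep R) := by
  rintro V s t n (h | ⟨i, h⟩) hn hc
  -- Parallel reduction contains β whatever relation evaluates the conditions; level 0 is taken, and
  -- the projection lands in level 1.
  · obtain ⟨n', h1, h2, h3⟩ := Par.projects hR_algebraic hR_arity (substClosed_condStepAt R 0)
      (projects_condStepAt hR_algebraic hR_arity 0) V s t n (Par.of_beta h) hn hc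
    exact ⟨n', h1, h2, reflTransGen_mono (fun _ _ h => ⟨1, h⟩) h3⟩
  · obtain ⟨n', h1, h2, h3⟩ := projects_condStepAt hR_algebraic hR_arity i V s t n h hn hc
    exact ⟨n', h1, h2, reflTransGen_mono (fun _ _ h => ⟨i, h⟩) h3⟩

end LamRew

/-! ### Confluence -/

theorem theorem2 {F : Type*} {X : Type*} [Infinite X] (ar : F → ℕ)
    (R : Set (LamRew.Rule F X))
    (hR_algebraic : ∀ ρ ∈ R, ρ.Algebraic)
    (hR_arity : ∀ ρ ∈ R, ρ.ArityCompliant ar)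
    (hR_confluent : LamRew.Confluent (LamRew.CondStep R X)) :
    LamRew.ConfluentOn (LamRew.BetaCondStep R X) (LamRew.ArityCompliantNF ar X) := by
  rintro s ⟨n, hn, hc⟩ t u ht hu
  have hsn := LamRew.Term.norm_of_isBetaNormalForm hn
  have hP := LamRew.projects_betaCondStep hR_algebraic hR_arity
  rw [LamRew.Term.arityCompliant_iff] at hc
  obtain ⟨m, ⟨j, hm⟩, -, hnm⟩ := hP.reflTransGen ht hsn hc
  obtain ⟨m', ⟨k, hm'⟩, -, hnm'⟩ := hP.reflTransGen hu hsn hc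
  -- The normal forms `m` and `m'` of `t` and `u` are A-reducts of the same `n`.
  obtain ⟨w, h1, h2⟩ := hR_confluent n trivial m m' hnm hnm'
  exact ⟨w, (LamRew.reflTransGen_mono (fun _ _ => Or.inl) hm.betas).trans (LamRew.reflTransGen_mono (fun _ _ => Or.inr) h1),
    (LamRew.reflTransGen_mono (fun _ _ => Or.inl) hm'.betas).trans (LamRew.reflTransGen_mono (fun _ _ => Or.inr) h2)⟩
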